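/- Let $X$ be an order complete (Dedekind complete) real vector lattice with weak order unit $e \ge 0$, and let $X_s$ be its sup-completion, i.e. the (unique up to isomorphism) order complete cone with a biggest element whose group of invertible elements is $X$ and in which every $y$ satisfies $y=\sup\{u\in X: u\le y\}$, every $y\in X_s$ lying below an element of $X$ belongs to $X$, and finite infima with elements of $X$ distribute over suprema; concretely, $y\in X_s$ is identified with the set $\{u\in X:u\le y\}$, and the sets that occur are the nonempty lower subsets of $X$ that contain every supremum, existing in $X$, of a nonempty set of their elements. Let $T$ be a conditional expectation on $X$ with $Te=e$, i.e. a strictly positive order continuous linear projection $T:X\to X$ with $Te=e$ whose range is an order complete vector sublattice of $X$; extend $T$ to $X_s$ by $Tx=\sup\{Tu: u\in X,\ u\le x\}$. For $0\le x,y\in X_s$, $0\le a\in X_s$, $0\le u\in X$ and a real number $p\ge 1$ put $$(x-y)^+=\sup\{\,u-u\wedge y: u\in X,\ u\le x\,\},\qquad P_a u=\sup_{n\in\mathbb N}(u\wedge na)\in X,$$ and let $x^p$ and $xy$ be the increasing, left order continuous extensions to the positive cone of $X_s$ of the power and product of positive step elements over $e$, $$\Big(\sum_i t_ic_i\Big)^p=\sum_i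 t_i^p c_i,\qquad \Big(\sum_i t_ic_i\Big)\Big(\sum_j s_jd_j\Big)=\sum_{i,j}t_is_j\,(c_i\wedge d_j)$$ ($t_i,s_j\ge 0$ real; $(c_i)$ and $(d_j)$ finite families of pairwise disjoint components of $e$), i.e. $x^p$ is the supremum of $s^p$ over the positive step elements $s\le x$, and $xy$ is the supremum of $sr$ over the positive step elements $s\le x$ and $r\le y$. (On the positive cone of the universal completion of $X$ these are the usual power and $f$-algebra product with unit $e$.) Then for every real $p\ge 1$ and all $x,y\in X_s$ with $x\ge 0$, $y\ge 0$ and $y\in R(T)=\{Tz:z\in X_s\}$, $$y^p\; T P_{(x-y)^+}e\ \le\ T x^p .$$ -/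

import Mathlib

open scoped NNReal

/-- `e` is a weak order unit: `e ≥ 0`, and only `0` is disjoint from `e`. -/
def IsWeakUnit {X : Type*} [AddCommGroup X] [Lattice X] (e : X) : Prop :=
  0 ≤ e ∧ ∀ x : X, e ⊓ |x| = 0 → x = 0

/-- The sup-completion `X_s` of an order complete vector lattice `X`. An element `y` is encoded by
the set `{u : X | u ≤ y}` of the elements of `X` below it, of which it is the supremum. The sets
that occur are exactly the nonempty lower sets of `X` that contain every supremum, existing in `X`,
of a nonempty set of their elements. For `X = ℝ` these are the half-lines `(-∞, a]` and `ℝ`, so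
`X_s` is `ℝ ∪ {∞}`. -/
@[ext]
structure SupCompletion (X : Type*) [Lattice X] where
  /-- the elements of `X` below the given element of `X_s` -/
  lower : Set X
  nonempty : lower.Nonempty
  isLowerSet : IsLowerSet lower
  isLUB_mem : ∀ A : Set X, A ⊆ lower → A.Nonempty → ∀ a : X, IsLUB A a → a ∈ lower

namespace SupCompletion

section Order

variable {X : Type*} [Lattice X]

instance : PartialOrder (SupCompletion X) where
  le x y := x.lower ⊆ y.lower
  le_refl _ := subset_rfl
  le_trans _ _ _ h₁ h₂ := h₁.trans h₂
  le_antisymm _ _ h₁ h₂ := SupCompletion.ext (h₁.antisymm h₂)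

/-- The embedding of `X` into `X_s`. -/
def of (u : X) : SupCompletion X where
  lower := Set.Iic u
  nonempty := ⟨u, le_rfl⟩
  isLowerSet := isLowerSet_Iic u
  isLUB_mem _ hA _ _ ha := ha.2 hA

theorem of_le_iff {u : X} {x : SupCompletion X} : of u ≤ x ↔ u ∈ x.lower :=
  ⟨fun h => h (le_refl u), fun h _ hv => x.isLowerSet hv h⟩

theorem of_le_of {u v : X} : of u ≤ of v ↔ u ≤ v := of_le_iff

instance [Zero X] : Zero (SupCompletion X) := ⟨of 0⟩

/-- The biggest element of `X_s`. -/
instance [Nonempty X] : OrderTop (SupCompletion X) where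
  top := ⟨Set.univ, Set.univ_nonempty, isLowerSet_univ, fun _ _ _ _ _ => trivial⟩
  le_top _ := Set.subset_univ _

open Classical in
/-- The supremum of a nonempty set of elements of `X_s`. The value on the empty set is a
convention that plays no role. -/
noncomputable instance [Zero X] : SupSet (SupCompletion X) where
  sSup S :=
    if h : S.Nonempty then
      { lower := {u | ∀ z ∈ upperBounds S, u ∈ z.lower}
        nonempty := by
          obtain ⟨x, hx⟩ := h
          obtain ⟨u, hu⟩ := x.nonempty
          exact ⟨u, fun z hz => hz hx hu⟩
        isLowerSet := fun _ _ hba ha z hz => z.isLowerSet hba (ha z hz)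
        isLUB_mem := fun A hA hne a ha z hz =>
          z.isLUB_mem A (fun _ hu => hA hu z hz) hne a ha }
    else 0

/-- Every nonempty subset of `X_s` has a supremum. -/
theorem isLUB_sSup_of_nonempty [Zero X] {S : Set (SupCompletion X)} (hS : S.Nonempty) : IsLUB S (sSup S) := by
  have key : (sSup S).lower = {u | ∀ z ∈ upperBounds S, u ∈ z.lower} := by
    simp [sSup, hS]
  constructor
  · intro x hx u hu
    rw [key]
    exact fun z hz => hz hx hu
  · intro z hz u hu
    rw [key] at hu
    exact hu z hz

/-- Every element of `X_s` is the supremum of the elements of `X` below it. -/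
theorem isLUB_of_image_lower (x : SupCompletion X) : IsLUB (of '' x.lower) x := by
  constructor
  · rintro _ ⟨u, hu, rfl⟩
    exact of_le_iff.2 hu
  · intro z hz u hu
    exact of_le_iff.1 (hz ⟨u, hu, rfl⟩)

end Order

section Meet

variable {X : Type*} [ConditionallyCompleteLattice X]

/-- For `u ∈ X` and `y ∈ X_s` the infimum `u ∧ y`, which belongs to `X`. -/
noncomputable def meet (u : X) (y : SupCompletion X) : X :=
  sSup {v : X | v ≤ u ∧ v ∈ y.lower}

/-- `meet u y` is indeed the infimum of `u` and `y` in `X_s`. -/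
theorem isGLB_of_meet (u : X) (y : SupCompletion X) : IsGLB {of u, y} (of (meet u y)) := by
  have hne : {v : X | v ≤ u ∧ v ∈ y.lower}.Nonempty := by
    obtain ⟨w, hw⟩ := y.nonempty
    exact ⟨u ⊓ w, inf_le_left, y.isLowerSet inf_le_right hw⟩
  have hlub : IsLUB {v : X | v ≤ u ∧ v ∈ y.lower} (meet u y) :=
    isLUB_csSup hne ⟨u, fun _ hv => hv.1⟩
  constructor
  · rintro z (rfl | rfl)
    · exact of_le_of.2 (hlub.2 fun _ hv => hv.1)
    · exact of_le_iff.2 (z.isLUB_mem _ (fun _ hv => hv.2) hne _ hlub)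
  · intro z hz w hw
    exact hlub.1 ⟨hz (Set.mem_insert _ _) hw, hz (Set.mem_insert_of_mem _ rfl) hw⟩

end Meet

section Operations

variable {X : Type*} [AddCommGroup X] [ConditionallyCompleteLattice X]

/-- The sum in the cone `X_s`. -/
noncomputable instance : Add (SupCompletion X) where
  add x y := sSup {z | ∃ u ∈ x.lower, ∃ v ∈ y.lower, z = of (u + v)}

/-- Multiplication of the elements of the cone `X_s` by nonnegative reals. -/
noncomputable instance [Module ℝ X] : SMul ℝ≥0 (SupCompletion X) where
  smul r x := sSup {z | ∃ u ∈ x.lower, z = of ((r : ℝ) • u)}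

/-- `(x - y)⁺` for `0 ≤ x, y ∈ X_s`. For `u ∈ X` one has `(u - y)⁺ = u - u ∧ y ∈ X`, and
`(x - y)⁺` is the supremum of these elements over all `u ∈ X` with `u ≤ x`. -/
noncomputable def posDiff (x y : SupCompletion X) : SupCompletion X :=
  sSup {z | ∃ u ∈ x.lower, z = of (u - meet u y)}

/-- `P_a u = sup_n (u ∧ n a)` for `0 ≤ a ∈ X_s` and `0 ≤ u ∈ X`. -/
noncomputable def bandProjPos [Module ℝ X] (a : SupCompletion X) (u : X) : X :=
  sSup (Set.range fun n : ℕ => meet u ((n : ℝ≥0) • a))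

/-- The band projection `P_a` on `X` associated with `0 ≤ a ∈ X_s`. -/
noncomputable def bandProj [Module ℝ X] (a : SupCompletion X) (u : X) : X :=
  bandProjPos a u⁺ - bandProjPos a u⁻

/-- The extension of an (order continuous, increasing) map `T : X → X` to `X_s`:
`T x = sup {T u : u ∈ X, u ≤ x}`. -/
noncomputable def extend (T : X → X) (x : SupCompletion X) : SupCompletion X :=
  sSup {z | ∃ u ∈ x.lower, z = of (T u)}

end Operations

end SupCompletion

/-- (A representation of) a positive step element `∑ i, t i • c i` over the weak unit `e`: the
`t i` are nonnegative reals and the `c i` are pairwise disjoint components of `e`. -/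
structure StepElement {X : Type*} [AddCommGroup X] [Lattice X] (e : X) where
  size : ℕ
  coeff : Fin size → ℝ≥0
  comp : Fin size → X
  isComponent : ∀ i, comp i ⊓ (e - comp i) = 0
  disjoint : ∀ i j, i ≠ j → comp i ⊓ comp j = 0

namespace StepElement

variable {X : Type*} [AddCommGroup X] [Lattice X] [Module ℝ X] {e : X}

/-- The element `∑ i, t i • c i` of `X`. -/
noncomputable def val (s : StepElement e) : X :=
  ∑ i, (s.coeff i : ℝ) • s.comp i

/-- The power `(∑ i, t i • c i) ^ p = ∑ i, (t i) ^ p • c i`. -/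
noncomputable def rpow (s : StepElement e) (p : ℝ) : X :=
  ∑ i, ((s.coeff i : ℝ) ^ p) • s.comp i

/-- The product `(∑ i, t i • c i) * (∑ j, s j • d j) = ∑ i, ∑ j, (t i * s j) • (c i ∧ d j)`, that
is, the `f`-algebra product with unit `e`. -/
noncomputable def mul (s r : StepElement e) : X :=
  ∑ i, ∑ j, ((s.coeff i : ℝ) * (r.coeff j : ℝ)) • (s.comp i ⊓ r.comp j)

end StepElement

namespace SupCompletion

variable {X : Type*} [AddCommGroup X] [ConditionallyCompleteLattice X] [Module ℝ X]

/-- The power `x ^ p` of `0 ≤ x ∈ X_s`, with respect to the weak unit `e`. Every positive element of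
`X_s` is the supremum of the step elements below it (Freudenthal's spectral theorem), and
`x ↦ x ^ p` is the increasing, left order continuous extension to `X_s` of the power of step
elements. On the positive cone of the universal completion of `X`, this is the `p`-th power of the
functional calculus for which `e` is the constant `1`. -/
noncomputable def rpow (e : X) (x : SupCompletion X) (p : ℝ) : SupCompletion X :=
  sSup {z | ∃ s : StepElement e, s.val ∈ x.lower ∧ z = of (s.rpow p)}

/-- The product `x * y` of `0 ≤ x, y ∈ X_s`, with respect to the weak unit `e`: the increasing, left
order continuous extension to `X_s` of the product of step elements. On the positive cone of the
universal completion of `X`, this is the `f`-algebra product with unit `e`. -/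
noncomputable def mul (e : X) (x y : SupCompletion X) : SupCompletion X :=
  sSup {z | ∃ s r : StepElement e, s.val ∈ x.lower ∧ r.val ∈ y.lower ∧ z = of (s.mul r)}

end SupCompletion

/-- `T` is a conditional expectation operator on `X` with `T e = e`: a strictly positive, order
continuous linear projection that fixes `e` and whose range is an order complete vector sublattice
of `X`. (For a positive operator, order continuity means that `D ↓ 0` implies `T D ↓ 0`.) -/
structure IsConditionalExpectation {X : Type*} [AddCommGroup X] [Lattice X] [Module ℝ X]
    (e : X) (T : X →ₗ[ℝ] X) : Prop where
  idempotent : ∀ u, T (T u) = T u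
  strictlyPositive : ∀ u, 0 < u → 0 < T u
  orderContinuous : ∀ D : Set X, D.Nonempty → DirectedOn (· ≥ ·) D → IsGLB D 0 → IsGLB (T '' D) 0
  sup_mem_range : ∀ u ∈ Set.range T, ∀ v ∈ Set.range T, u ⊔ v ∈ Set.range T
  inf_mem_range : ∀ u ∈ Set.range T, ∀ v ∈ Set.range T, u ⊓ v ∈ Set.range T
  range_complete : ∀ A : Set (Set.range T), A.Nonempty → BddAbove A → ∃ a, IsLUB A a
  map_unit : T e = e

/-! This is Chebyshev's inequality: where `x` exceeds `y = T z` one has `y ≤ x`, and multiplication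
by `y` commutes with `T`. Since disjoint positive sums are suprema, a product of step elements can
be tested on one block `b`, a component of `e` with `σ b ≤ y ^ p` and `s b ≤ T q`, where `q = P e`
for the band of `(x - y)⁺`. Taking roots gives `t b ≤ y` with `t ^ p = σ`
(`smul_mem_lower_of_rpow_smul_mem`).

For `r < t`, the block `b` is the supremum of the `b ⊓ c`, where `c` is the component generated by
`(T u - r e)⁺` and `u ≤ z` (`isLUB_inf_generatedComponent`). Each `c` is fixed by `T`, and `r (c ⊓
q)` lies below `y`, hence below `x` (`mem_lower_of_le_smul_bandProjPos`). So `r ^ p T (c ⊓ q) ≤ T x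
^ p`, while averaging gives `s (b ⊓ c) ≤ T (c ⊓ q)` (`smul_le_map_inf`). Suprema over `u` and then
over `r < t` finish the block. -/

set_option linter.unusedSectionVars false

/-! ### Components and disjointness in vector lattices -/

section VectorLattice

variable {X : Type*} [AddCommGroup X] [Lattice X] [IsOrderedAddMonoid X]

theorem inf_add_le_inf_add_inf {a b c : X} (ha : 0 ≤ a) (hb : 0 ≤ b) (hc : 0 ≤ c) :
    a ⊓ (b + c) ≤ a ⊓ b + a ⊓ c := by
  rw [add_inf, inf_add, inf_add]
  refine le_inf (le_inf ?_ ?_) (le_inf ?_ ?_)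
  · exact inf_le_left.trans (le_add_of_nonneg_right ha)
  · exact inf_le_left.trans (le_add_of_nonneg_left hb)
  · exact inf_le_left.trans (le_add_of_nonneg_right hc)
  · exact inf_le_right

theorem sub_inf_inf_sub_inf (a b : X) : (a - a ⊓ b) ⊓ (b - a ⊓ b) = 0 := by
  rw [sub_eq_add_neg, sub_eq_add_neg, ← inf_add, add_neg_cancel]

theorem sup_eq_add_of_inf_eq_zero {a b : X} (h : a ⊓ b = 0) : a ⊔ b = a + b := by
  have := inf_add_sup a b
  rwa [h, zero_add] at this

/-- Finite infima distribute over arbitrary suprema. -/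
theorem IsLUB.inf_le_of_forall {A : Set X} {a m w : X} (ha : IsLUB A a)
    (h : ∀ v ∈ A, v ⊓ m ≤ w) : a ⊓ m ≤ w := by
  -- By `v + m = v ⊓ m + v ⊔ m`, the bound on `v ⊓ m` becomes an upper bound for `v` that no longer
  -- depends on `v`.
  have h1 : a ≤ w - m + a ⊔ m := by
    refine ha.2 fun v hv => ?_
    have h2 := inf_add_sup v m
    have h3 : v ⊔ m ≤ a ⊔ m := sup_le_sup_right (ha.1 hv) m
    calc v = v ⊓ m - m + v ⊔ m := by rw [sub_add_eq_add_sub, h2, add_sub_cancel_right]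
      _ ≤ w - m + a ⊔ m := add_le_add (sub_le_sub_right (h v hv) m) h3
  have h2 := inf_add_sup a m
  calc a ⊓ m = a + m - a ⊔ m := by rw [← h2, add_sub_cancel_right]
    _ ≤ (w - m + a ⊔ m) + m - a ⊔ m := sub_le_sub_right (add_le_add_left h1 m) _
    _ = w := by abel

theorem component_nonneg {c e : X} (hc : c ⊓ (e - c) = 0) : 0 ≤ c := hc ▸ inf_le_left

theorem component_le {c e : X} (hc : c ⊓ (e - c) = 0) : c ≤ e :=
  sub_nonneg.1 (hc ▸ inf_le_right)

theorem component_of_inf_le_zero {c e : X} (h0 : 0 ≤ c) (h1 : c ≤ e) (h : c ⊓ (e - c) ≤ 0) :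
    c ⊓ (e - c) = 0 :=
  h.antisymm (le_inf h0 (sub_nonneg.2 h1))

theorem component_inf {c d e : X} (hc : c ⊓ (e - c) = 0) (hd : d ⊓ (e - d) = 0) :
    (c ⊓ d) ⊓ (e - c ⊓ d) = 0 := by
  have hc0 := component_nonneg hc
  have hd0 := component_nonneg hd
  have hc1 := sub_nonneg.2 (component_le hc)
  have hd1 := sub_nonneg.2 (component_le hd)
  have h0 : 0 ≤ c ⊓ d := le_inf hc0 hd0
  refine component_of_inf_le_zero h0 (inf_le_left.trans (component_le hc)) ?_
  have h1 : e - c ⊓ d ≤ (e - c) + (e - d) := by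
    have : c + d - e ≤ c ⊓ d := by
      refine le_inf ?_ ?_
      · rw [add_sub_assoc]
        exact add_le_of_nonpos_right (sub_nonpos.2 (component_le hd))
      · rw [add_comm, add_sub_assoc]
        exact add_le_of_nonpos_right (sub_nonpos.2 (component_le hc))
    calc e - c ⊓ d ≤ e - (c + d - e) := sub_le_sub_left this e
      _ = _ := by abel
  calc (c ⊓ d) ⊓ (e - c ⊓ d) ≤ (c ⊓ d) ⊓ ((e - c) + (e - d)) := inf_le_inf_left _ h1
    _ ≤ (c ⊓ d) ⊓ (e - c) + (c ⊓ d) ⊓ (e - d) := inf_add_le_inf_add_inf h0 hc1 hd1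
    _ ≤ c ⊓ (e - c) + d ⊓ (e - d) :=
      add_le_add (inf_le_inf_right _ inf_le_left) (inf_le_inf_right _ inf_le_right)
    _ = 0 := by rw [hc, hd, add_zero]

theorem component_sub {b c e : X} (hb : b ⊓ (e - b) = 0) (hc : c ⊓ (e - c) = 0) (hcb : c ≤ b) :
    (b - c) ⊓ (e - (b - c)) = 0 := by
  have hc0 := component_nonneg hc
  have h0 : 0 ≤ b - c := sub_nonneg.2 hcb
  have h1 : b - c ≤ b := sub_le_self b hc0
  refine component_of_inf_le_zero h0 (h1.trans (component_le hb)) ?_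
  calc (b - c) ⊓ (e - (b - c)) = (b - c) ⊓ ((e - b) + c) := by congr 1; abel
    _ ≤ (b - c) ⊓ (e - b) + (b - c) ⊓ c :=
      inf_add_le_inf_add_inf h0 (sub_nonneg.2 (component_le hb)) hc0
    _ ≤ b ⊓ (e - b) + (e - c) ⊓ c :=
      add_le_add (inf_le_inf_right _ h1)
        (inf_le_inf_right _ (sub_le_sub_right (component_le hb) c))
    _ = 0 := by rw [hb, inf_comm, hc, add_zero]

theorem component_of_isLUB {A : Set X} {a e : X} (hA : ∀ v ∈ A, v ⊓ (e - v) = 0)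
    (hne : A.Nonempty) (ha : IsLUB A a) : a ⊓ (e - a) = 0 := by
  obtain ⟨v, hv⟩ := hne
  refine component_of_inf_le_zero ((component_nonneg (hA v hv)).trans (ha.1 hv))
    (ha.2 fun v hv => component_le (hA v hv)) (ha.inf_le_of_forall fun v hv => ?_)
  calc v ⊓ (e - a) ≤ v ⊓ (e - v) := inf_le_inf_left _ (sub_le_sub_left (ha.1 hv) e)
    _ ≤ 0 := (hA v hv).le

/-- A component splits every element between `0` and `e`. -/
theorem le_inf_add_inf_sub {b c e : X} (hb : 0 ≤ b) (hbe : b ≤ e) (hc : c ⊓ (e - c) = 0) :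
    b ≤ b ⊓ c + b ⊓ (e - c) := by
  calc b = b ⊓ (c + (e - c)) := by rw [add_sub_cancel, inf_eq_left.2 hbe]
    _ ≤ _ := inf_add_le_inf_add_inf hb (component_nonneg hc) (sub_nonneg.2 (component_le hc))

section Module

variable [Module ℝ X] [IsOrderedModule ℝ X]

theorem smul_inf_smul_le_zero {a b : X} (ha : 0 ≤ a) (hb : 0 ≤ b) (h : a ⊓ b ≤ 0) {r s : ℝ} :
    r • a ⊓ s • b ≤ 0 := by
  -- A common bound for both scalars, at least 1 so that it can be inverted whatever their signs.
  set N : ℝ := max 1 (max r s)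
  have hN : 0 < N := lt_of_lt_of_le one_pos (le_max_left _ _)
  have h1 : N⁻¹ • (r • a ⊓ s • b) ≤ 0 := by
    refine le_trans (le_inf ?_ ?_) h
    · calc N⁻¹ • (r • a ⊓ s • b) ≤ N⁻¹ • (N • a) :=
            smul_le_smul_of_nonneg_left (inf_le_left.trans
              (smul_le_smul_of_nonneg_right ((le_max_left r s).trans (le_max_right _ _)) ha))
              (inv_nonneg.2 hN.le)
        _ = a := inv_smul_smul₀ hN.ne' a
    · calc N⁻¹ • (r • a ⊓ s • b) ≤ N⁻¹ • (N • b) :=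
            smul_le_smul_of_nonneg_left (inf_le_right.trans
              (smul_le_smul_of_nonneg_right ((le_max_right r s).trans (le_max_right _ _)) hb))
              (inv_nonneg.2 hN.le)
        _ = b := inv_smul_smul₀ hN.ne' b
  calc r • a ⊓ s • b = N • (N⁻¹ • (r • a ⊓ s • b)) := (smul_inv_smul₀ hN.ne' _).symm
    _ ≤ N • (0 : X) := smul_le_smul_of_nonneg_left h1 hN.le
    _ = 0 := smul_zero N

theorem inf_smul_le_zero {a b : X} (ha : 0 ≤ a) (hb : 0 ≤ b) (h : a ⊓ b ≤ 0) (s : ℝ) :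
    a ⊓ s • b ≤ 0 := by
  simpa using smul_inf_smul_le_zero ha hb h (r := 1) (s := s)

/-- Such an `a` is disjoint from `s • b`, which dominates it, hence from itself. This is how
excesses are shown to vanish below. -/
theorem nonpos_of_le_smul_of_inf_le_zero {a b : X} (ha : 0 ≤ a) (hb : 0 ≤ b) (h : a ⊓ b ≤ 0)
    {s : ℝ} (hs : a ≤ s • b) : a ≤ 0 :=
  (le_inf le_rfl hs).trans (inf_smul_le_zero ha hb h s)

theorem IsLUB.const_smul {A : Set X} {a : X} (ha : IsLUB A a) {r : ℝ} (hr : 0 < r) :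
    IsLUB ((fun v => r • v) '' A) (r • a) := by
  constructor
  · rintro _ ⟨v, hv, rfl⟩
    exact smul_le_smul_of_nonneg_left (ha.1 hv) hr.le
  · intro w hw
    have h : a ≤ r⁻¹ • w := ha.2 fun v hv => by
      have := smul_le_smul_of_nonneg_left (hw ⟨v, hv, rfl⟩) (inv_nonneg.2 hr.le)
      rwa [inv_smul_smul₀ hr.ne'] at this
    have := smul_le_smul_of_nonneg_left h hr.le
    rwa [smul_inv_smul₀ hr.ne'] at this

theorem nonpos_of_smul_le_smul {k : X} {s t : ℝ} (hst : s < t) (h : t • k ≤ s • k) : k ≤ 0 := by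
  have h1 : (t - s) • k ≤ 0 := by rw [sub_smul]; exact sub_nonpos.2 h
  have h2 := smul_le_smul_of_nonneg_left h1 (inv_nonneg.2 (sub_pos.2 hst).le)
  rwa [inv_smul_smul₀ (sub_pos.2 hst).ne', smul_zero] at h2

/-- If `v ≤ s e` on the component `m`, then `v ⊓ t m ≤ s m`. -/
theorem inf_smul_component_le {m e v : X} (hm : m ⊓ (e - m) = 0) {s t : ℝ} (hs : 0 ≤ s)
    (ht : 0 ≤ t) (h : m ⊓ ((v - s • e) ⊔ 0) ≤ 0) : v ⊓ t • m ≤ s • m := by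
  have hm0 := component_nonneg hm
  have hn0 := sub_nonneg.2 (component_le hm)
  have he0 : 0 ≤ e := hm0.trans (component_le hm)
  have h1 : v ⊓ t • m ≤ s • e := by
    -- The excess over `s e` is below `t m` and disjoint from `m`.
    have h2 : (v ⊓ t • m - s • e) ⊔ 0 ≤ 0 := by
      refine nonpos_of_le_smul_of_inf_le_zero (s := t) le_sup_right hm0 ?_ ?_
      · rw [inf_comm]
        exact (inf_le_inf_left m (sup_le_sup_right (sub_le_sub_right inf_le_left _) 0)).trans h
      · refine sup_le ?_ (smul_nonneg ht hm0)
        exact (sub_le_self _ (smul_nonneg hs he0)).trans inf_le_right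
    exact sub_nonpos.1 (le_sup_left.trans h2)
  calc v ⊓ t • m ≤ t • m ⊓ (s • m + s • (e - m)) := by
        rw [← smul_add, add_sub_cancel]
        exact le_inf inf_le_right h1
    _ ≤ t • m ⊓ s • m + t • m ⊓ s • (e - m) :=
      inf_add_le_inf_add_inf (smul_nonneg ht hm0) (smul_nonneg hs hm0) (smul_nonneg hs hn0)
    _ ≤ s • m + 0 := add_le_add inf_le_right (smul_inf_smul_le_zero hm0 hn0 hm.le)
    _ = s • m := add_zero _

end Module

end VectorLattice

/-! ### Archimedean property and generated components -/

section DedekindComplete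

variable {X : Type*} [AddCommGroup X] [ConditionallyCompleteLattice X] [IsOrderedAddMonoid X]
  [Module ℝ X] [IsOrderedModule ℝ X]

/-- A Dedekind complete vector lattice is Archimedean. -/
theorem nonpos_of_forall_nat_smul_le {d b : X} (h : ∀ n : ℕ, (n : ℝ) • d ≤ b) : d ≤ 0 := by
  have hg := isLUB_csSup (s := Set.range fun n : ℕ => (n : ℝ) • d) ⟨_, 0, rfl⟩
    ⟨b, by rintro _ ⟨n, rfl⟩; exact h n⟩
  set g := sSup (Set.range fun n : ℕ => (n : ℝ) • d)
  have h1 : g ≤ g - d := hg.2 (by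
    rintro _ ⟨n, rfl⟩
    have := hg.1 ⟨n + 1, rfl⟩
    simp only [Nat.cast_add, Nat.cast_one, add_smul, one_smul] at this
    exact le_sub_iff_add_le.2 this)
  simpa using h1

/-- The gap between `R b` and an upper bound is at most `(R / n) b` for every `n ≥ 1`, so the
Archimedean property closes it. This removes the slack `r < t` in later arguments. -/
theorem isLUB_smul_lt {b : X} (hb : 0 ≤ b) {R : ℝ} (hR : 0 < R) :
    IsLUB ((fun r : ℝ => r • b) '' Set.Ico 0 R) (R • b) := by
  constructor
  · rintro _ ⟨r, hr, rfl⟩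
    exact smul_le_smul_of_nonneg_right hr.2.le hb
  · intro w hw
    refine sub_nonpos.1 (nonpos_of_forall_nat_smul_le (b := R • b) fun n => ?_)
    rcases Nat.eq_zero_or_pos n with rfl | hn
    · simpa using smul_nonneg hR.le hb
    have hn' : (0 : ℝ) < n := Nat.cast_pos.2 hn
    have hn1 : (1 : ℝ) ≤ n := Nat.one_le_cast.2 hn
    have h1 : (R - R / n) • b ≤ w := hw ⟨R - R / n, ⟨sub_nonneg.2 (div_le_self hR.le hn1),
      sub_lt_self R (div_pos hR hn')⟩, rfl⟩
    calc (n : ℝ) • (R • b - w) ≤ (n : ℝ) • (R • b - (R - R / n) • b) :=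
          smul_le_smul_of_nonneg_left (sub_le_sub_left h1 _) hn'.le
      _ = R • b := by
        rw [← sub_smul, smul_smul]
        congr 1
        field_simp
        ring

/-- The component of `e` generated by `w ≥ 0`, that is, the band projection `P_w e`. -/
noncomputable def generatedComponent (e w : X) : X :=
  sSup (Set.range fun n : ℕ => e ⊓ (n : ℝ) • w)

variable {e w : X}

theorem isLUB_generatedComponent (e w : X) :
    IsLUB (Set.range fun n : ℕ => e ⊓ (n : ℝ) • w) (generatedComponent e w) :=
  isLUB_csSup ⟨_, 0, rfl⟩ ⟨e, by rintro _ ⟨n, rfl⟩; exact inf_le_left⟩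

theorem generatedComponent_le : generatedComponent e w ≤ e :=
  (isLUB_generatedComponent e w).2 (by rintro _ ⟨n, rfl⟩; exact inf_le_left)

theorem inf_le_generatedComponent : e ⊓ w ≤ generatedComponent e w := by
  simpa using (isLUB_generatedComponent e w).1 ⟨1, rfl⟩

theorem generatedComponent_nonneg (he : 0 ≤ e) (hw : 0 ≤ w) : 0 ≤ generatedComponent e w :=
  (le_inf he hw).trans inf_le_generatedComponent

theorem generatedComponent_inf_le_zero {m : X} (hm : 0 ≤ m) (hw : 0 ≤ w) (h : m ⊓ w ≤ 0) :
    generatedComponent e w ⊓ m ≤ 0 :=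
  (isLUB_generatedComponent e w).inf_le_of_forall (by
    rintro _ ⟨n, rfl⟩
    exact (le_inf inf_le_right (inf_le_left.trans inf_le_right)).trans
      (inf_smul_le_zero hm hw h n))

/-- Adding the left side `d` to `e ⊓ n w` stays below `e ⊓ (n + 1) w`, so `k - d` still bounds the
family whose supremum is `k`. No sign of `w` is needed. -/
theorem sub_generatedComponent_inf_le_zero :
    (e - generatedComponent e w) ⊓ w ≤ 0 := by
  set k := generatedComponent e w
  set d := (e - k) ⊓ w
  have h : k ≤ k - d := (isLUB_generatedComponent e w).2 (by
    rintro _ ⟨n, rfl⟩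
    refine le_sub_iff_add_le.2 (le_trans (le_inf ?_ ?_)
      ((isLUB_generatedComponent e w).1 ⟨n + 1, rfl⟩))
    · calc e ⊓ (n : ℝ) • w + d ≤ k + (e - k) :=
            add_le_add ((isLUB_generatedComponent e w).1 ⟨n, rfl⟩) inf_le_left
        _ = e := add_sub_cancel _ _
    · push_cast
      rw [add_smul, one_smul]
      exact add_le_add inf_le_right inf_le_right)
  simpa using h

theorem component_generatedComponent (he : 0 ≤ e) (hw : 0 ≤ w) :
    generatedComponent e w ⊓ (e - generatedComponent e w) = 0 :=
  component_of_inf_le_zero (generatedComponent_nonneg he hw) generatedComponent_le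
    (generatedComponent_inf_le_zero (sub_nonneg.2 generatedComponent_le) hw
      sub_generatedComponent_inf_le_zero)

/-- `v ≥ s e` on the component generated by `(v - s e)⁺`. -/
theorem smul_generatedComponent_le (he : 0 ≤ e) (v : X) {s : ℝ} (hs : 0 ≤ s) :
    s • generatedComponent e ((v - s • e) ⊔ 0) ≤ v ⊔ 0 := by
  set w := (v - s • e) ⊔ 0
  set c := generatedComponent e w
  have hw : 0 ≤ w := le_sup_right
  have hc : 0 ≤ c := generatedComponent_nonneg he hw
  -- The excess is below `(s e - v)⁺`, which is disjoint from `w = (v - s e)⁺` and so from `c`; it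
  -- is also below `s c`.
  have h0 : (s • c - v ⊔ 0) ⊔ 0 ≤ 0 := by
    refine nonpos_of_le_smul_of_inf_le_zero (s := s) le_sup_right hc ?_ ?_
    · rw [inf_comm]
      refine generatedComponent_inf_le_zero le_sup_right hw ?_
      have h1 := (sub_inf_inf_sub_inf (s • e) v).le
      refine le_trans (inf_le_inf ?_ ?_) h1
      · refine sup_le (sub_le_sub (smul_le_smul_of_nonneg_left generatedComponent_le hs)
          (inf_le_right.trans le_sup_left)) (sub_nonneg.2 inf_le_left)
      · exact sup_le (sub_le_sub_left inf_le_left v) (sub_nonneg.2 inf_le_right)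
    · exact sup_le (sub_le_self _ le_sup_right) (smul_nonneg hs hc)
  exact sub_nonpos.1 (le_sup_left.trans h0)

end DedekindComplete

/-! ### Infima and band projections in the sup-completion -/

namespace SupCompletion

section Lattice

variable {X : Type*} [Lattice X]

theorem zero_mem_lower [Zero X] {x : SupCompletion X} (hx : 0 ≤ x) : (0 : X) ∈ x.lower :=
  of_le_iff.1 hx

theorem sup_mem_lower (x : SupCompletion X) {u v : X} (hu : u ∈ x.lower) (hv : v ∈ x.lower) :
    u ⊔ v ∈ x.lower :=
  x.isLUB_mem {u, v} (by rintro _ (rfl | rfl) <;> assumption) ⟨u, Or.inl rfl⟩ _ isLUB_pair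

theorem mem_sSup_lower [Zero X] {S : Set (SupCompletion X)} {u : X} (h : of u ∈ S) :
    u ∈ (sSup S).lower :=
  of_le_iff.1 ((isLUB_sSup_of_nonempty ⟨_, h⟩).1 h)

/-- The elements `v` with `v ⊓ m ≤ w`, as an element of the sup-completion. -/
def boundedOn [AddCommGroup X] [IsOrderedAddMonoid X] (m w : X) : SupCompletion X where
  lower := {v | v ⊓ m ≤ w}
  nonempty := ⟨w, inf_le_left⟩
  isLowerSet _ _ hba ha := (inf_le_inf_right m hba).trans ha
  isLUB_mem _ hA _ _ ha := ha.inf_le_of_forall hA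

/-- A sum of pairwise disjoint positive elements is their supremum, and lower sets of elements of
`X_s` are closed under suprema. Powers and products of step elements are thereby treated one block
at a time. -/
theorem sum_mem_lower [AddCommGroup X] [IsOrderedAddMonoid X] {z : SupCompletion X}
    (hz : 0 ≤ z) {ι : Type*} (s : Finset ι) (f : ι → X) (hf : ∀ i ∈ s, 0 ≤ f i)
    (hd : ∀ i ∈ s, ∀ j ∈ s, i ≠ j → f i ⊓ f j ≤ 0) (hm : ∀ i ∈ s, f i ∈ z.lower) :
    ∑ i ∈ s, f i ∈ z.lower := by
  classical
  induction s using Finset.induction_on with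
  | empty => simpa using zero_mem_lower hz
  | insert a s ha ih =>
    have hsum : ∀ t ⊆ s, f a ⊓ ∑ i ∈ t, f i ≤ 0 ∧ 0 ≤ ∑ i ∈ t, f i := by
      intro t
      induction t using Finset.induction_on with
      | empty => simp
      | insert b t hb iht =>
        intro hbt
        have hbs : b ∈ s := hbt (Finset.mem_insert_self b t)
        obtain ⟨h1, h2⟩ := iht ((Finset.subset_insert b t).trans hbt)
        have hfb := hf b (Finset.mem_insert_of_mem hbs)
        rw [Finset.sum_insert hb]
        refine ⟨?_, add_nonneg hfb h2⟩
        calc f a ⊓ (f b + ∑ i ∈ t, f i) ≤ f a ⊓ f b + f a ⊓ ∑ i ∈ t, f i :=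
              inf_add_le_inf_add_inf (hf a (Finset.mem_insert_self a s)) hfb h2
          _ ≤ 0 + 0 := add_le_add (hd a (Finset.mem_insert_self a s) b
            (Finset.mem_insert_of_mem hbs) (by rintro rfl; exact ha hbs)) h1
          _ = 0 := add_zero 0
    obtain ⟨h1, h2⟩ := hsum s subset_rfl
    rw [Finset.sum_insert ha, ← sup_eq_add_of_inf_eq_zero
      (h1.antisymm (le_inf (hf a (Finset.mem_insert_self a s)) h2))]
    refine z.sup_mem_lower (hm a (Finset.mem_insert_self a s)) (ih ?_ ?_ ?_)
    · exact fun i hi => hf i (Finset.mem_insert_of_mem hi)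
    · exact fun i hi j hj => hd i (Finset.mem_insert_of_mem hi) j (Finset.mem_insert_of_mem hj)
    · exact fun i hi => hm i (Finset.mem_insert_of_mem hi)

end Lattice

section Meet

variable {X : Type*} [ConditionallyCompleteLattice X]

theorem meet_mem_lower (u : X) (y : SupCompletion X) : meet u y ∈ y.lower :=
  of_le_iff.1 ((isGLB_of_meet u y).1 (Or.inr rfl))

theorem meet_le (u : X) (y : SupCompletion X) : meet u y ≤ u :=
  of_le_of.1 ((isGLB_of_meet u y).1 (Or.inl rfl))

theorem le_meet {u v : X} {y : SupCompletion X} (h1 : v ≤ u) (h2 : v ∈ y.lower) :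
    v ≤ meet u y :=
  of_le_of.1 ((isGLB_of_meet u y).2 (by
    rintro z (rfl | rfl)
    · exact of_le_of.2 h1
    · exact of_le_iff.2 h2))

end Meet

section Operations

variable {X : Type*} [AddCommGroup X] [ConditionallyCompleteLattice X] [IsOrderedAddMonoid X]
  [Module ℝ X] [IsOrderedModule ℝ X]

theorem smul_mem_lower {a : SupCompletion X} {u : X} (hu : u ∈ a.lower) (n : ℕ) :
    (n : ℝ) • u ∈ (((n : ℝ≥0)) • a).lower :=
  mem_sSup_lower ⟨u, hu, by simp⟩

theorem isLUB_bandProjPos (a : SupCompletion X) (u : X) :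
    IsLUB (Set.range fun n : ℕ => meet u ((n : ℝ≥0) • a)) (bandProjPos a u) :=
  isLUB_csSup ⟨_, 0, rfl⟩ ⟨u, by rintro _ ⟨n, rfl⟩; exact meet_le _ _⟩

theorem bandProjPos_le (a : SupCompletion X) (u : X) : bandProjPos a u ≤ u :=
  (isLUB_bandProjPos a u).2 (by rintro _ ⟨n, rfl⟩; exact meet_le _ _)

theorem zero_mem_smul_lower {a : SupCompletion X} (ha : 0 ≤ a) (n : ℕ) :
    (0 : X) ∈ ((n : ℝ≥0) • a).lower := by
  simpa using smul_mem_lower (zero_mem_lower ha) n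

theorem bandProjPos_nonneg {a : SupCompletion X} (ha : 0 ≤ a) {u : X} (hu : 0 ≤ u) :
    0 ≤ bandProjPos a u :=
  (le_meet hu (zero_mem_smul_lower ha 0)).trans ((isLUB_bandProjPos a u).1 ⟨0, rfl⟩)

theorem bandProj_eq_bandProjPos {a : SupCompletion X} (ha : 0 ≤ a) {u : X} (hu : 0 ≤ u) :
    bandProj a u = bandProjPos a u := by
  have h : bandProjPos a (0 : X) = 0 :=
    (bandProjPos_le a 0).antisymm (bandProjPos_nonneg ha le_rfl)
  rw [bandProj, posPart_of_nonneg hu, negPart_of_nonneg hu, h, sub_zero]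

theorem bandProjPos_inf_le_zero {a : SupCompletion X} {m : X} (hm : 0 ≤ m)
    (h : ∀ v ∈ a.lower, v ⊓ m ≤ 0) (u : X) : bandProjPos a u ⊓ m ≤ 0 := by
  refine (isLUB_bandProjPos a u).inf_le_of_forall ?_
  rintro _ ⟨n, rfl⟩
  -- `boundedOn m 0` is an element of `X_s`, so being disjoint from `m` becomes an upper bound that
  -- passes to suprema.
  have hle : (n : ℝ≥0) • a ≤ boundedOn m 0 := by
    refine (isLUB_sSup_of_nonempty ?_).2 ?_
    · obtain ⟨v, hv⟩ := a.nonempty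
      exact ⟨_, v, hv, rfl⟩
    · rintro _ ⟨v, hv, rfl⟩
      refine of_le_iff.2 ?_
      have h1 : (v ⊔ 0) ⊓ m ≤ 0 :=
        isLUB_pair.inf_le_of_forall (by
          rintro _ (rfl | rfl)
          · exact h _ hv
          · exact inf_le_left)
      have h2 := inf_smul_le_zero hm le_sup_right (by rwa [inf_comm]) (n : ℝ)
      change _ ⊓ m ≤ 0
      rw [inf_comm]
      refine le_trans (inf_le_inf_left m ?_) h2
      simpa using smul_le_smul_of_nonneg_left (le_sup_left (a := v) (b := 0)) (Nat.cast_nonneg' n)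
  exact hle (meet_mem_lower _ _)

theorem component_bandProjPos {a : SupCompletion X} (ha : 0 ≤ a) {e : X} (he : 0 ≤ e) :
    bandProjPos a e ⊓ (e - bandProjPos a e) = 0 := by
  refine component_of_inf_le_zero (bandProjPos_nonneg ha he) (bandProjPos_le a e)
    (bandProjPos_inf_le_zero (sub_nonneg.2 (bandProjPos_le a e)) (fun v hv => ?_) e)
  have hk : generatedComponent e v ≤ bandProjPos a e :=
    (isLUB_generatedComponent e v).2 (by
      rintro _ ⟨n, rfl⟩
      exact (le_meet inf_le_left (((n : ℝ≥0) • a).isLowerSet inf_le_right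
        (smul_mem_lower hv n))).trans ((isLUB_bandProjPos a e).1 ⟨n, rfl⟩))
  rw [inf_comm]
  exact (inf_le_inf_right v (sub_le_sub_left hk e)).trans sub_generatedComponent_inf_le_zero

theorem posDiff_nonneg {x y : SupCompletion X} (hx : 0 ≤ x) : 0 ≤ posDiff x y := by
  refine of_le_iff.2 ((posDiff x y).isLowerSet (sub_nonneg.2 (meet_le 0 y)) ?_)
  exact mem_sSup_lower ⟨0, zero_mem_lower hx, rfl⟩

/-- On the band generated by `(x - y)⁺` one has `y ≤ x`. -/
theorem mem_lower_of_le_smul_bandProjPos {x y : SupCompletion X} (hx : 0 ≤ x) {e v : X}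
    (he : 0 ≤ e) (hv0 : 0 ≤ v) (hvy : v ∈ y.lower) {t : ℝ}
    (hv : v ≤ t • bandProjPos (posDiff x y) e) : v ∈ x.lower := by
  set w := v - meet v x
  have hw0 : 0 ≤ w := sub_nonneg.2 (meet_le v x)
  have hwv : w ≤ v := sub_le_self v (le_meet hv0 (zero_mem_lower hx))
  -- Here `w = (v - x)⁺`. For `u ≤ x` and `v ≤ y`, `(u - y)⁺ ≤ (u - v)⁺` and `w ≤ (v - u)⁺`, and
  -- these two bounds are disjoint.
  have ha : posDiff x y ≤ boundedOn w 0 := by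
    refine (isLUB_sSup_of_nonempty ?_).2 ?_
    · obtain ⟨u, hu⟩ := x.nonempty
      exact ⟨_, u, hu, rfl⟩
    · rintro _ ⟨u, hu, rfl⟩
      refine of_le_iff.2 (le_trans (inf_le_inf ?_ ?_) (sub_inf_inf_sub_inf u v).le)
      · exact sub_le_sub_left (le_meet inf_le_left (y.isLowerSet inf_le_right hvy)) u
      · exact sub_le_sub_left (le_meet inf_le_right (x.isLowerSet inf_le_left hu)) v
  have hq := bandProjPos_inf_le_zero hw0 (fun _ hz => ha hz) e
  have hw : w ≤ 0 := nonpos_of_le_smul_of_inf_le_zero hw0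
    (bandProjPos_nonneg (posDiff_nonneg hx) he) (by rwa [inf_comm]) (hwv.trans hv)
  exact x.isLowerSet (sub_nonpos.1 hw) (meet_mem_lower v x)

theorem map_mem_extend_lower {T : X → X} {x : SupCompletion X} {u : X} (hu : u ∈ x.lower) :
    T u ∈ (extend T x).lower :=
  mem_sSup_lower ⟨u, hu, rfl⟩

theorem extend_le {T : X → X} {x z : SupCompletion X} (h : ∀ u ∈ x.lower, T u ∈ z.lower) :
    extend T x ≤ z := by
  refine (isLUB_sSup_of_nonempty ?_).2 ?_
  · obtain ⟨u, hu⟩ := x.nonempty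
    exact ⟨_, u, hu, rfl⟩
  · rintro _ ⟨u, hu, rfl⟩
    exact of_le_iff.2 (h u hu)

end Operations

end SupCompletion

/-! ### Step elements and their blocks -/

namespace StepElement

variable {X : Type*} [AddCommGroup X] [Lattice X] [IsOrderedAddMonoid X] {e : X}

theorem comp_nonneg (s : StepElement e) (i : Fin s.size) : 0 ≤ s.comp i :=
  component_nonneg (s.isComponent i)

/-- The step element `t c`. -/
def single {c : X} (hc : c ⊓ (e - c) = 0) (t : ℝ≥0) : StepElement e where
  size := 1
  coeff _ := t
  comp _ := c
  isComponent _ := hc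
  disjoint i j hij := absurd (Subsingleton.elim i j) hij

/-- The step element `0`, as an empty sum. -/
def empty (e : X) : StepElement e where
  size := 0
  coeff _ := 0
  comp _ := 0
  isComponent i := i.elim0
  disjoint i := i.elim0

variable [Module ℝ X] [IsOrderedModule ℝ X]

theorem val_single {c : X} (hc : c ⊓ (e - c) = 0) (t : ℝ≥0) : (single hc t).val = (t : ℝ) • c :=
  Fin.sum_univ_one fun _ => (t : ℝ) • c

theorem rpow_single {c : X} (hc : c ⊓ (e - c) = 0) (t : ℝ≥0) (p : ℝ) :
    (single hc t).rpow p = ((t : ℝ) ^ p) • c :=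
  Fin.sum_univ_one fun _ => ((t : ℝ) ^ p) • c

theorem val_empty (e : X) : (empty e).val = 0 :=
  Fin.sum_univ_zero _

theorem smul_comp_le_val (s : StepElement e) (i : Fin s.size) :
    (s.coeff i : ℝ) • s.comp i ≤ s.val :=
  Finset.single_le_sum (f := fun i => (s.coeff i : ℝ) • s.comp i)
    (fun j _ => smul_nonneg (s.coeff j).coe_nonneg (s.comp_nonneg j)) (Finset.mem_univ i)

theorem rpow_mem_lower {z : SupCompletion X} (hz : 0 ≤ z) (s : StepElement e) {p : ℝ}
    (h : ∀ i, ((s.coeff i : ℝ) ^ p) • s.comp i ∈ z.lower) : s.rpow p ∈ z.lower :=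
  SupCompletion.sum_mem_lower hz _ _
    (fun i _ => smul_nonneg (Real.rpow_nonneg (s.coeff i).coe_nonneg p) (s.comp_nonneg i))
    (fun i _ j _ hij => smul_inf_smul_le_zero (s.comp_nonneg i) (s.comp_nonneg j)
      (s.disjoint i j hij).le)
    fun i _ => h i

theorem mul_mem_lower {z : SupCompletion X} (hz : 0 ≤ z) (s r : StepElement e)
    (h : ∀ i j, ((s.coeff i : ℝ) * (r.coeff j : ℝ)) • (s.comp i ⊓ r.comp j) ∈ z.lower) :
    s.mul r ∈ z.lower := by
  have h0 : ∀ i j, 0 ≤ s.comp i ⊓ r.comp j := fun i j => le_inf (s.comp_nonneg i) (r.comp_nonneg j)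
  rw [mul, ← Fintype.sum_prod_type']
  refine SupCompletion.sum_mem_lower hz _ _ (fun ij _ => ?_) (fun ij _ kl _ hne => ?_)
    fun ij _ => h ij.1 ij.2
  · exact smul_nonneg (mul_nonneg (s.coeff ij.1).coe_nonneg (r.coeff ij.2).coe_nonneg) (h0 _ _)
  · refine smul_inf_smul_le_zero (h0 _ _) (h0 _ _) ?_
    by_cases hi : ij.1 = kl.1
    · have hj : ij.2 ≠ kl.2 := fun hj => hne (Prod.ext hi hj)
      exact (inf_le_inf inf_le_right inf_le_right).trans (r.disjoint _ _ hj).le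
    · exact (inf_le_inf inf_le_left inf_le_left).trans (s.disjoint _ _ hi).le

end StepElement

/-! ### Powers in the sup-completion -/

namespace SupCompletion

variable {X : Type*} [AddCommGroup X] [ConditionallyCompleteLattice X] [IsOrderedAddMonoid X]
  [Module ℝ X] [IsOrderedModule ℝ X] {e : X} {p : ℝ}

theorem rpow_smul_mem_rpow_lower {x : SupCompletion X} {c : X} (hc : c ⊓ (e - c) = 0) {t : ℝ}
    (ht : 0 ≤ t) (h : t • c ∈ x.lower) : t ^ p • c ∈ (rpow e x p).lower := by
  lift t to ℝ≥0 using ht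
  refine mem_sSup_lower ⟨StepElement.single hc t, ?_, ?_⟩
  · rwa [StepElement.val_single]
  · rw [StepElement.rpow_single]

theorem rpow_le {x z : SupCompletion X} (hx : 0 ≤ x) (hz : 0 ≤ z)
    (h : ∀ (t : ℝ) (c : X), 0 ≤ t → c ⊓ (e - c) = 0 → t • c ∈ x.lower → t ^ p • c ∈ z.lower) :
    rpow e x p ≤ z := by
  refine (isLUB_sSup_of_nonempty ?_).2 ?_
  · refine ⟨_, StepElement.empty e, ?_, rfl⟩
    rw [StepElement.val_empty]
    exact zero_mem_lower hx
  · rintro _ ⟨s, hs, rfl⟩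
    exact of_le_iff.2 (s.rpow_mem_lower hz fun i => h _ _ (s.coeff i).coe_nonneg (s.isComponent i)
      (x.isLowerSet (s.smul_comp_le_val i) hs))

theorem rpow_nonneg (he : 0 ≤ e) {x : SupCompletion X} (hx : 0 ≤ x) : 0 ≤ rpow e x p := by
  have := rpow_smul_mem_rpow_lower (e := e) (p := p) (x := x) (c := 0) (t := 0) (by simpa using he)
    le_rfl (by simpa using zero_mem_lower hx)
  exact of_le_iff.2 (by simpa using this)

/-- The power on the sup-completion reflects the order below multiples of components of `e`. -/
theorem smul_mem_lower_of_rpow_smul_mem (he : IsWeakUnit e) (hp : 0 < p) {y : SupCompletion X}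
    (hy : 0 ≤ y) {b : X} (hb : b ⊓ (e - b) = 0) {t : ℝ} (ht : 0 < t)
    (h : t ^ p • b ∈ (rpow e y p).lower) : t • b ∈ y.lower := by
  have hb0 := component_nonneg hb
  refine y.isLUB_mem _ ?_ ((Set.nonempty_Ico.2 ht).image _) _ (isLUB_smul_lt hb0 ht)
  rintro _ ⟨r, ⟨hr0, hrt⟩, rfl⟩
  change r • b ∈ y.lower
  -- The defect `(r b - y)⁺`; it is shown to vanish through the component `k` it generates.
  set w := r • b - meet (r • b) y
  have hw0 : 0 ≤ w := sub_nonneg.2 (meet_le _ _)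
  have hwb : w ≤ r • b := sub_le_self _ (le_meet (smul_nonneg hr0 hb0) (zero_mem_lower hy))
  set k := generatedComponent e w
  have hk : k ⊓ (e - k) = 0 := component_generatedComponent he.1 hw0
  have hk0 := component_nonneg hk
  have hkb : k ≤ b := by
    have h1 : k ⊓ (e - b) ≤ 0 := by
      refine generatedComponent_inf_le_zero (sub_nonneg.2 (component_le hb)) hw0 ?_
      refine (inf_le_inf_left _ hwb).trans (inf_smul_le_zero (sub_nonneg.2 (component_le hb)) hb0
        (by rw [inf_comm]; exact hb.le) r)
    calc k ≤ k ⊓ b + k ⊓ (e - b) := le_inf_add_inf_sub hk0 (component_le hk) hb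
      _ ≤ b + 0 := add_le_add inf_le_right h1
      _ = b := add_zero b
  -- On `k`, `y ^ p` should not exceed `r ^ p`. A block `s c` of `y` with `s ≤ r` obeys this. If `s
  -- > r`, then `r m ≤ y` on `m = c ⊓ k`, so `w` is disjoint from `m`, hence so is `k`, and `m = 0`.
  have hbound : rpow e y p ≤ boundedOn (t ^ p • k) (r ^ p • k) := by
    have hrk : 0 ≤ r ^ p • k := smul_nonneg (Real.rpow_nonneg hr0 p) hk0
    refine rpow_le hy (of_le_iff.2 (inf_le_left.trans hrk)) fun s c hs hc hsc => ?_
    change s ^ p • c ⊓ t ^ p • k ≤ r ^ p • k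
    have hc0 := component_nonneg hc
    rcases le_or_gt s r with hsr | hrs
    · refine inf_smul_component_le hk (Real.rpow_nonneg hr0 p) (Real.rpow_nonneg ht.le p) ?_
      have : s ^ p • c - r ^ p • e ≤ 0 := sub_nonpos.2
        ((smul_le_smul_of_nonneg_left (component_le hc) (Real.rpow_nonneg hs p)).trans
          (smul_le_smul_of_nonneg_right (Real.rpow_le_rpow hs hsr hp.le) he.1))
      rw [sup_eq_right.2 this]
      exact inf_le_right
    · refine le_trans (smul_inf_smul_le_zero hc0 hk0 ?_) hrk
      set m := c ⊓ k
      have hm : m ⊓ (e - m) = 0 := component_inf hc hk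
      have hm0 := component_nonneg hm
      have hmb : m ≤ b := inf_le_right.trans hkb
      have h1 : r • m ≤ meet (r • b) y := by
        refine le_meet (smul_le_smul_of_nonneg_left hmb hr0) (y.isLowerSet ?_ hsc)
        exact (smul_le_smul_of_nonneg_right hrs.le hm0).trans
          (smul_le_smul_of_nonneg_left inf_le_left hs)
      have h2 : w ≤ r • (b - m) := by
        rw [smul_sub]
        exact sub_le_sub_left h1 _
      have h3 : m ⊓ w ≤ 0 := (inf_le_inf_left m h2).trans
        (inf_smul_le_zero hm0 (sub_nonneg.2 hmb)
          ((inf_le_inf_left m (sub_le_sub_right (component_le hb) m)).trans hm.le) r)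
      exact (le_inf inf_le_right le_rfl).trans (generatedComponent_inf_le_zero hm0 hw0 h3)
  have htk : t ^ p • k ⊓ t ^ p • k ≤ r ^ p • k :=
    hbound ((rpow e y p).isLowerSet (smul_le_smul_of_nonneg_left hkb (Real.rpow_nonneg ht.le p)) h)
  rw [inf_idem] at htk
  have hk' : k ≤ 0 := nonpos_of_smul_le_smul (Real.rpow_lt_rpow hr0 hrt hp) htk
  have hw : w = 0 := he.2 w (by
    rw [abs_of_nonneg hw0]
    exact (inf_le_generatedComponent.trans hk').antisymm (le_inf he.1 hw0))
  have : r • b = meet (r • b) y := sub_eq_zero.1 hw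
  rw [this]
  exact meet_mem_lower _ _

end SupCompletion

/-! ### Averaging and the inequality on one block -/

namespace IsConditionalExpectation

variable {X : Type*} [AddCommGroup X] [ConditionallyCompleteLattice X] [IsOrderedAddMonoid X]
  [Module ℝ X] [IsOrderedModule ℝ X] {e : X} {T : X →ₗ[ℝ] X}

theorem map_nonneg (hT : IsConditionalExpectation e T) {u : X} (hu : 0 ≤ u) : 0 ≤ T u := by
  rcases hu.eq_or_lt with rfl | hu
  · rw [map_zero]
  · exact (hT.strictlyPositive u hu).le

theorem monotone (hT : IsConditionalExpectation e T) {u v : X} (h : u ≤ v) : T u ≤ T v := by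
  have := hT.map_nonneg (sub_nonneg.2 h)
  rwa [map_sub, sub_nonneg] at this

theorem map_eq_self (hT : IsConditionalExpectation e T) {u : X} (hu : u ∈ Set.range T) :
    T u = u := by
  obtain ⟨v, rfl⟩ := hu
  exact hT.idempotent v

theorem map_generatedComponent (hT : IsConditionalExpectation e T) {w : X} (hw0 : 0 ≤ w)
    (hw : w ∈ Set.range T) : T (generatedComponent e w) = generatedComponent e w := by
  set k := generatedComponent e w
  have hlub : IsLUB (Set.range fun n : ℕ => e ⊓ (n : ℝ) • w) k := isLUB_generatedComponent e w
  have hfix : ∀ n : ℕ, T (e ⊓ (n : ℝ) • w) = e ⊓ (n : ℝ) • w := fun n =>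
    hT.map_eq_self (hT.inf_mem_range _ ⟨e, hT.map_unit⟩ _
      ⟨(n : ℝ) • w, by rw [map_smul, hT.map_eq_self hw]⟩)
  -- The `e ⊓ n w` are fixed by `T` and increase to `k`; order continuity, which concerns families
  -- decreasing to `0`, is applied to the differences.
  have hglb := hT.orderContinuous (Set.range fun n : ℕ => k - e ⊓ (n : ℝ) • w) ⟨_, 0, rfl⟩
    (by
      rintro _ ⟨m, rfl⟩ _ ⟨n, rfl⟩
      refine ⟨_, ⟨max m n, rfl⟩, ?_, ?_⟩
      · exact sub_le_sub_left (inf_le_inf_left e (smul_le_smul_of_nonneg_right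
          (Nat.cast_le.2 (le_max_left m n)) hw0)) k
      · exact sub_le_sub_left (inf_le_inf_left e (smul_le_smul_of_nonneg_right
          (Nat.cast_le.2 (le_max_right m n)) hw0)) k)
    ⟨by
      rintro _ ⟨n, rfl⟩
      exact sub_nonneg.2 (hlub.1 ⟨n, rfl⟩), fun z hz => by
      have : k ≤ k - z := hlub.2 (by
        rintro _ ⟨n, rfl⟩
        exact le_sub_comm.1 (hz ⟨n, rfl⟩))
      simpa using this⟩
  refine IsLUB.unique ⟨?_, fun z hz => ?_⟩ hlub
  · rintro _ ⟨n, rfl⟩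
    have := hT.monotone (hlub.1 ⟨n, rfl⟩)
    rwa [hfix] at this
  · refine sub_nonpos.1 (hglb.2 ?_)
    rintro _ ⟨_, ⟨n, rfl⟩, rfl⟩
    rw [map_sub, hfix]
    exact sub_le_sub_left (hz ⟨n, rfl⟩) _

/-- The averaging property for a component `c` in the range of `T`: below multiples of components
`b ≤ c`, the elements `T q` and `T (c ⊓ q)` coincide. -/
theorem smul_le_map_inf (hT : IsConditionalExpectation e T) {b c q : X} (hb0 : 0 ≤ b)
    (hc : c ⊓ (e - c) = 0) (hTc : T c = c) (hq0 : 0 ≤ q) (hqe : q ≤ e) (hbc : b ≤ c) {s : ℝ}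
    (hs : 0 ≤ s) (h : s • b ≤ T q) : s • b ≤ T (c ⊓ q) := by
  have hc0 := component_nonneg hc
  have hn0 := sub_nonneg.2 (component_le hc)
  have h1 : T q ≤ T (c ⊓ q) + T ((e - c) ⊓ q) := by
    rw [← map_add, inf_comm c, inf_comm (e - c)]
    exact hT.monotone (le_inf_add_inf_sub hq0 hqe hc)
  have h2 : T ((e - c) ⊓ q) ≤ e - c := by
    have := hT.monotone (inf_le_left : (e - c) ⊓ q ≤ e - c)
    rwa [map_sub T e c, hT.map_unit, hTc] at this
  -- Since `b ≤ c`, the part of `T q` coming from `e - c` contributes nothing below `s b`.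
  have h3 : s • b ⊓ (e - c) ≤ 0 := by
    rw [inf_comm]
    exact inf_smul_le_zero hn0 hb0 ((inf_le_inf_left _ hbc).trans (by rw [inf_comm]; exact hc.le)) s
  calc s • b ≤ s • b ⊓ (T (c ⊓ q) + T ((e - c) ⊓ q)) := le_inf le_rfl (h.trans h1)
    _ ≤ s • b ⊓ T (c ⊓ q) + s • b ⊓ T ((e - c) ⊓ q) :=
      inf_add_le_inf_add_inf (smul_nonneg hs hb0) (hT.map_nonneg (le_inf hc0 hq0))
        (hT.map_nonneg (le_inf hn0 hq0))
    _ ≤ T (c ⊓ q) + 0 := add_le_add inf_le_right ((inf_le_inf_left _ h2).trans h3)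
    _ = T (c ⊓ q) := add_zero _

open SupCompletion in
/-- If `t b ≤ T z` for a component `b` of `e` and `r < t`, then `b` is exhausted by the components
of `e` on which `T u ≥ r e` for some `u ≤ z`. -/
theorem isLUB_inf_generatedComponent (he : 0 ≤ e) {z : SupCompletion X} {b : X}
    (hb : b ⊓ (e - b) = 0) {r t : ℝ} (hr : 0 ≤ r) (hrt : r < t)
    (h : t • b ∈ (extend T z).lower) :
    IsLUB ((fun u => b ⊓ generatedComponent e ((T u - r • e) ⊔ 0)) '' z.lower) b := by
  set c : X → X := fun u => generatedComponent e ((T u - r • e) ⊔ 0)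
  set A := (fun u => b ⊓ c u) '' z.lower
  have hc : ∀ u, c u ⊓ (e - c u) = 0 := fun u => component_generatedComponent he le_sup_right
  have hAb : b ∈ upperBounds A := by
    rintro _ ⟨u, -, rfl⟩
    exact inf_le_left
  have hAne : A.Nonempty := z.nonempty.image _
  have hlub : IsLUB A (sSup A) := isLUB_csSup hAne ⟨b, hAb⟩
  set M := sSup A
  have hM : M ⊓ (e - M) = 0 := component_of_isLUB (by
    rintro _ ⟨u, -, rfl⟩
    exact component_inf hb (hc u)) hAne hlub
  have hMb : M ≤ b := hlub.2 hAb
  set m := b - M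
  have hm : m ⊓ (e - m) = 0 := component_sub hb hM hMb
  have hm0 := component_nonneg hm
  have hmb : m ≤ b := sub_le_self b (component_nonneg hM)
  have hmc : ∀ u ∈ z.lower, m ⊓ c u ≤ 0 := fun u hu => by
    have h1 : m ≤ e - c u := by
      calc m ≤ b - b ⊓ c u := sub_le_sub_left (hlub.1 ⟨u, hu, rfl⟩) b
        _ ≤ b ⊓ (e - c u) := sub_le_iff_le_add'.2
          (le_inf_add_inf_sub (component_nonneg hb) (component_le hb) (hc u))
        _ ≤ e - c u := inf_le_right
    exact (inf_le_inf_right _ h1).trans (by rw [inf_comm]; exact (hc u).le)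
  -- The remainder `m` is disjoint from all the `c u`, so each `T u`, and hence `T z`, is at most
  -- `r` on `m`. But `t m ≤ T z` with `r < t`, which forces `m = 0`.
  have hz : extend T z ≤ boundedOn (t • m) (r • m) := extend_le fun u hu => by
    refine inf_smul_component_le hm hr (hr.trans hrt.le) (le_trans (le_inf inf_le_left ?_)
      (hmc u hu))
    exact (inf_le_inf_right _ (component_le hm)).trans inf_le_generatedComponent
  have htm : t • m ⊓ t • m ≤ r • m :=
    hz ((extend T z).isLowerSet (smul_le_smul_of_nonneg_left hmb (hr.trans hrt.le)) h)
  rw [inf_idem] at htm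
  have hbM : b = M := (sub_nonpos.1 (nonpos_of_smul_le_smul hrt htm)).antisymm hMb
  rwa [← hbM] at hlub

open SupCompletion in
-- Chebyshev's inequality on a single block. The slack `r < t` is needed because `T z` is only a
-- supremum of the `T u`, which need not reach `t` on any part of `b`.
theorem rpow_mul_smul_mem_extend_rpow (hT : IsConditionalExpectation e T) (he : 0 ≤ e) {p : ℝ}
    (hp : 0 < p) {x z : SupCompletion X} (hx : 0 ≤ x) (hz : 0 ≤ extend T z) {b : X}
    (hb : b ⊓ (e - b) = 0) {s t : ℝ} (hs : 0 < s) (ht : 0 < t)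
    (h1 : t • b ∈ (extend T z).lower)
    (h2 : s • b ≤ T (bandProjPos (posDiff x (extend T z)) e)) :
    (t ^ p * s) • b ∈ (extend T (rpow e x p)).lower := by
  set y := extend T z
  set q := bandProjPos (posDiff x y) e
  set L := extend T (rpow e x p)
  have hq : q ⊓ (e - q) = 0 := component_bandProjPos (posDiff_nonneg hx) he
  have hq0 := component_nonneg hq
  have hb0 := component_nonneg hb
  have key : ∀ r : ℝ, 0 < r → r < t → (r ^ p * s) • b ∈ L.lower := fun r hr hrt => by
    have hrp : 0 < r ^ p := Real.rpow_pos_of_pos hr p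
    refine L.isLUB_mem _ ?_ ((z.nonempty.image _).image _) _
      ((isLUB_inf_generatedComponent he hb hr.le hrt h1).const_smul (mul_pos hrp hs))
    rintro _ ⟨_, ⟨u, hu, rfl⟩, rfl⟩
    set w := (T u - r • e) ⊔ 0
    set c := generatedComponent e w
    have hc : c ⊓ (e - c) = 0 := component_generatedComponent he le_sup_right
    have hTc : T c = c := hT.map_generatedComponent le_sup_right
      (hT.sup_mem_range _ ⟨u - r • e, by rw [map_sub, map_smul, hT.map_unit]⟩ _ ⟨0, map_zero T⟩)
    have hcq := component_inf hc hq
    have hmem : r • (c ⊓ q) ∈ x.lower := by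
      refine mem_lower_of_le_smul_bandProjPos hx he (smul_nonneg hr.le (component_nonneg hcq))
        (y.isLowerSet ?_ (y.sup_mem_lower (map_mem_extend_lower hu) (zero_mem_lower hz)))
        (smul_le_smul_of_nonneg_left inf_le_right hr.le)
      exact (smul_le_smul_of_nonneg_left inf_le_left hr.le).trans
        (smul_generatedComponent_le he (T u) hr.le)
    have hL : T (r ^ p • (c ⊓ q)) ∈ L.lower :=
      map_mem_extend_lower (rpow_smul_mem_rpow_lower hcq hr.le hmem)
    refine L.isLowerSet ?_ hL
    change (r ^ p * s) • (b ⊓ c) ≤ _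
    rw [map_smul, mul_smul]
    refine smul_le_smul_of_nonneg_left (hT.smul_le_map_inf (le_inf hb0 (component_nonneg hc)) hc hTc
      hq0 (component_le hq) inf_le_right hs.le ?_) hrp.le
    exact (smul_le_smul_of_nonneg_left inf_le_left hs.le).trans h2
  have htp : 0 < t ^ p * s := mul_pos (Real.rpow_pos_of_pos ht p) hs
  refine L.isLUB_mem _ ?_ ((Set.nonempty_Ico.2 htp).image _) _ (isLUB_smul_lt hb0 htp)
  rintro _ ⟨a, ⟨ha0, hat⟩, rfl⟩
  have hL0 : (0 : X) ∈ L.lower := by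
    have := map_mem_extend_lower (T := T) (zero_mem_lower (rpow_nonneg (p := p) he hx))
    rwa [map_zero] at this
  rcases ha0.eq_or_lt with rfl | ha
  · simpa using hL0
  · have has : 0 < a / s := div_pos ha hs
    -- The value of `r` for which `r ^ p * s = a`.
    have := key ((a / s) ^ p⁻¹) (Real.rpow_pos_of_pos has _)
      ((Real.rpow_inv_lt_iff_of_pos has.le ht.le hp).2 ((div_lt_iff₀ hs).2 hat))
    rwa [Real.rpow_inv_rpow has.le hp.ne', div_mul_cancel₀ _ hs.ne'] at this

end IsConditionalExpectation

/-! ### The inequality, assembled from the blocks -/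

theorem proposition2p4 {X : Type*} [AddCommGroup X] [ConditionallyCompleteLattice X]
    [IsOrderedAddMonoid X] [Module ℝ X] [IsOrderedModule ℝ X]
    (e : X) (he : IsWeakUnit e)
    (T : X →ₗ[ℝ] X) (hT : IsConditionalExpectation e T)
    (p : ℝ) (hp : 1 ≤ p)
    (x y : SupCompletion X) (hx : 0 ≤ x) (hy : 0 ≤ y)
    (hyT : y ∈ Set.range (SupCompletion.extend T)) :
    SupCompletion.mul e (SupCompletion.rpow e y p)
        (SupCompletion.of (T (SupCompletion.bandProj (SupCompletion.posDiff x y) e))) ≤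
      SupCompletion.extend T (SupCompletion.rpow e x p) := by
  obtain ⟨z, rfl⟩ := hyT
  have hp0 : 0 < p := one_pos.trans_le hp
  have ha := SupCompletion.posDiff_nonneg (y := SupCompletion.extend T z) hx
  rw [SupCompletion.bandProj_eq_bandProjPos ha he.1]
  have hL0 : (0 : X) ∈ (SupCompletion.extend T (SupCompletion.rpow e x p)).lower := by
    have := SupCompletion.map_mem_extend_lower (T := T)
      (SupCompletion.zero_mem_lower (SupCompletion.rpow_nonneg (p := p) he.1 hx))
    rwa [map_zero] at this
  refine (SupCompletion.isLUB_sSup_of_nonempty ?_).2 ?_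
  · refine ⟨_, StepElement.empty e, StepElement.empty e, ?_, ?_, rfl⟩ <;>
      rw [StepElement.val_empty]
    · exact SupCompletion.zero_mem_lower (SupCompletion.rpow_nonneg he.1 hy)
    · exact hT.map_nonneg (SupCompletion.bandProjPos_nonneg ha he.1)
  rintro _ ⟨s, r, hs, hr, rfl⟩
  refine SupCompletion.of_le_iff.2 (s.mul_mem_lower (SupCompletion.of_le_iff.2 hL0) r
    fun i j => ?_)
  rcases (s.coeff i).coe_nonneg.eq_or_lt with hsi | hsi
  · rw [← hsi, zero_mul, zero_smul]
    exact hL0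
  rcases (r.coeff j).coe_nonneg.eq_or_lt with hrj | hrj
  · rw [← hrj, mul_zero, zero_smul]
    exact hL0
  have hb := component_inf (s.isComponent i) (r.isComponent j)
  have hpow : ((s.coeff i : ℝ) ^ p⁻¹) ^ p = s.coeff i := Real.rpow_inv_rpow hsi.le hp0.ne'
  have h1 := SupCompletion.smul_mem_lower_of_rpow_smul_mem he hp0 hy hb
    (Real.rpow_pos_of_pos hsi p⁻¹) (by
      rw [hpow]
      exact SupCompletion.isLowerSet _ ((smul_le_smul_of_nonneg_left inf_le_left hsi.le).trans
        (s.smul_comp_le_val i)) hs)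
  have h2 := hT.rpow_mul_smul_mem_extend_rpow he.1 hp0 hx hy hb hrj
    (Real.rpow_pos_of_pos hsi p⁻¹) h1
    (((smul_le_smul_of_nonneg_left inf_le_right hrj.le).trans (r.smul_comp_le_val j)).trans hr)
  rwa [hpow] at h2
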